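/- Let $m\ge 2$ and let $E_1,\dots,E_m,F$ be (real) Banach lattices. An $m$-linear (in particular, linear) operator between Riesz spaces is positive if it maps tuples of positive elements to positive elements, and regular if it is a difference of two positive $m$-linear operators. Suppose that for all $j=2,\dots,m-1$ and $i=1,\dots,m-j$ every regular linear operator $E_j\to E_{j+i}^*$ is weakly compact (for $m=2$ this condition is void), and that $E_1^*$ has order continuous norm. Then for every regular $m$-linear operator $A\colon E_1\times\cdots\times E_m\to F$ the Arens extension $A^{*[m+1]}\colon E_1^{**}\times\cdots\times E_m^{**}\to F^{**}$ is separately order continuous on $E_1^{**}\times\cdots\times E_m^{**}$. Here the Arens extension is $$A^{*[m+1]}(x_1^{**},\dots,x_m^{**})(y^*)=\big(\overline{x_1^{**}}\circ\cdots\circ\overline{x_m^{**}}\big)(y^*\circ A)\qquad(y^*\in F^*),$$ where $\overline{x_k^{**}}$ maps a $k$-linear form $B$ on $E_1\times\cdots\times E_k$ to the $(k-1)$-linear form $(x_1,\dots,x_{k-1})\mapsto x_k^{**}\big(B(x_1,\dots,x_{k-1},\bullet)\big)$ (a scalar if $k=1$). Separately order continuous means that for every $j$ and all fixed $x_k^{**}\in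 E_k^{**}$, $k\ne j$, the linear operator $x_j^{**}\in E_j^{**}\mapsto A^{*[m+1]}(x_1^{**},\dots,x_m^{**})\in F^{**}$ maps nets order convergent to $0$ to nets order convergent to $0$; a net $(x_\alpha)$ in a Riesz space is order convergent to $x$ if there is a net $(y_\alpha)$, with the same index set, such that $y_\alpha\downarrow 0$ and $|x_\alpha-x|\le y_\alpha$ for every $\alpha$. -/

import Mathlib

open Filter Topology
open scoped Pointwise

set_option linter.unusedSectionVars false

/-!
A *Banach lattice* is a real Banach space `E` with a lattice order, carrying the classes
`[NormedAddCommGroup E] [NormedSpace ℝ E] [CompleteSpace E] [Lattice E] [IsOrderedAddMonoid E]`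
`[IsOrderedModule ℝ E] [HasSolidNorm E]`.
-/

namespace BanachLattice

section Dual

variable {E : Type*} [NormedAddCommGroup E] [NormedSpace ℝ E] [Lattice E] [IsOrderedAddMonoid E]
  [HasSolidNorm E]

theorem norm_posPart_le (x : E) : ‖x⁺‖ ≤ ‖x‖ := by
  apply HasSolidNorm.solid
  rw [abs_of_nonneg (posPart_nonneg x), posPart_def]
  exact sup_le (le_abs_self x) (abs_nonneg x)

theorem norm_negPart_le (x : E) : ‖x⁻‖ ≤ ‖x‖ := by
  rw [← posPart_neg, ← norm_neg x]; exact norm_posPart_le _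

theorem norm_le_of_nonneg_of_le {x y : E} (hx : 0 ≤ x) (hxy : x ≤ y) : ‖x‖ ≤ ‖y‖ := by
  apply HasSolidNorm.solid
  rwa [abs_of_nonneg hx, abs_of_nonneg (hx.trans hxy)]

theorem Icc_add_Icc_zero {x y : E} (hx : 0 ≤ x) (hy : 0 ≤ y) :
    Set.Icc (0 : E) x + Set.Icc (0 : E) y = Set.Icc (0 : E) (x + y) := by
  ext z
  simp only [Set.mem_add, Set.mem_Icc]
  constructor
  · rintro ⟨a, ⟨ha, hax⟩, b, ⟨hb, hby⟩, rfl⟩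
    exact ⟨add_nonneg ha hb, add_le_add hax hby⟩
  · rintro ⟨hz, hzxy⟩
    refine ⟨z ⊓ x, ⟨le_inf hz hx, inf_le_right⟩, z - z ⊓ x,
      ⟨sub_nonneg.2 inf_le_left, ?_⟩, by abel⟩
    rw [sub_le_iff_le_add', ← sub_le_iff_le_add]
    exact le_inf (sub_le_self z hy) (sub_le_iff_le_add.2 hzxy)

theorem dual_apply_le (φ : StrongDual ℝ E) {x z : E} (hz : z ∈ Set.Icc (0 : E) x) :
    φ z ≤ ‖φ‖ * ‖x‖ :=
  (le_abs_self _).trans ((φ.le_opNorm z).trans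
    (mul_le_mul_of_nonneg_left (norm_le_of_nonneg_of_le hz.1 hz.2) (norm_nonneg _)))

theorem bddAbove_image_Icc (φ : StrongDual ℝ E) (x : E) :
    BddAbove (φ '' Set.Icc (0 : E) x) := by
  refine ⟨‖φ‖ * ‖x‖, ?_⟩
  rintro _ ⟨z, hz, rfl⟩
  exact dual_apply_le φ hz

/-- For `x ≥ 0` this is the value `sup {φ z | 0 ≤ z ≤ x}` of the positive part of `φ`. -/
noncomputable def conePosPart (φ : StrongDual ℝ E) (x : E) : ℝ :=
  sSup (φ '' Set.Icc (0 : E) x)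

theorem conePosPart_le (φ : StrongDual ℝ E) {x : E} (hx : 0 ≤ x) {c : ℝ}
    (h : ∀ z, 0 ≤ z → z ≤ x → φ z ≤ c) : conePosPart φ x ≤ c := by
  refine csSup_le ⟨φ 0, 0, ⟨le_rfl, hx⟩, rfl⟩ ?_
  rintro _ ⟨z, hz, rfl⟩
  exact h z hz.1 hz.2

theorem le_conePosPart (φ : StrongDual ℝ E) {x z : E} (hz : 0 ≤ z) (hzx : z ≤ x) :
    φ z ≤ conePosPart φ x :=
  le_csSup (bddAbove_image_Icc φ x) ⟨z, ⟨hz, hzx⟩, rfl⟩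

theorem conePosPart_nonneg (φ : StrongDual ℝ E) {x : E} (hx : 0 ≤ x) : 0 ≤ conePosPart φ x := by
  simpa using le_conePosPart φ le_rfl hx

theorem conePosPart_add (φ : StrongDual ℝ E) {x y : E} (hx : 0 ≤ x) (hy : 0 ≤ y) :
    conePosPart φ (x + y) = conePosPart φ x + conePosPart φ y := by
  unfold conePosPart
  rw [← Icc_add_Icc_zero hx hy, Set.image_add φ]
  exact csSup_add ⟨φ 0, 0, ⟨le_rfl, hx⟩, rfl⟩ (bddAbove_image_Icc φ x)
    ⟨φ 0, 0, ⟨le_rfl, hy⟩, rfl⟩ (bddAbove_image_Icc φ y)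

/-- The positive part of a functional, as an additive map. -/
noncomputable def posPartAddHom (φ : StrongDual ℝ E) : E →+ ℝ where
  toFun x := conePosPart φ x⁺ - conePosPart φ x⁻
  map_zero' := by simp
  map_add' x y := by
    have h : (x + y)⁺ + (x⁻ + y⁻) = (x + y)⁻ + (x⁺ + y⁺) := by
      have h1 := posPart_sub_negPart (x + y)
      have h2 := posPart_sub_negPart x
      have h3 := posPart_sub_negPart y
      have : (x + y)⁺ - (x + y)⁻ = (x⁺ - x⁻) + (y⁺ - y⁻) := by rw [h1, h2, h3]
      rw [sub_eq_iff_eq_add] at this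
      rw [this]; abel
    have h' := congrArg (conePosPart φ) h
    rw [conePosPart_add φ (posPart_nonneg _) (add_nonneg (negPart_nonneg _) (negPart_nonneg _)),
      conePosPart_add φ (negPart_nonneg _) (negPart_nonneg _),
      conePosPart_add φ (negPart_nonneg _) (add_nonneg (posPart_nonneg _) (posPart_nonneg _)),
      conePosPart_add φ (posPart_nonneg _) (posPart_nonneg _)] at h'
    linarith

theorem posPartAddHom_bound (φ : StrongDual ℝ E) (x : E) :
    ‖posPartAddHom φ x‖ ≤ ‖φ‖ * ‖x‖ := by
  have h1 := conePosPart_nonneg φ (posPart_nonneg x)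
  have h2 := conePosPart_nonneg φ (negPart_nonneg x)
  have h3 : conePosPart φ x⁺ ≤ ‖φ‖ * ‖x‖ :=
    (conePosPart_le φ (posPart_nonneg x) fun z hz hzx => dual_apply_le φ ⟨hz, hzx⟩).trans
      (mul_le_mul_of_nonneg_left (norm_posPart_le x) (norm_nonneg _))
  have h4 : conePosPart φ x⁻ ≤ ‖φ‖ * ‖x‖ :=
    (conePosPart_le φ (negPart_nonneg x) fun z hz hzx => dual_apply_le φ ⟨hz, hzx⟩).trans
      (mul_le_mul_of_nonneg_left (norm_negPart_le x) (norm_nonneg _))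
  change |conePosPart φ x⁺ - conePosPart φ x⁻| ≤ _
  rw [abs_le]; constructor <;> linarith

/-- The positive part of a functional. -/
noncomputable def dualPosPart (φ : StrongDual ℝ E) : StrongDual ℝ E :=
  (posPartAddHom φ).toRealLinearMap
    (AddMonoidHomClass.continuous_of_bound _ _ (posPartAddHom_bound φ))

theorem dualPosPart_apply (φ : StrongDual ℝ E) {x : E} (hx : 0 ≤ x) :
    dualPosPart φ x = conePosPart φ x := by
  change conePosPart φ x⁺ - conePosPart φ x⁻ = _
  rw [posPart_of_nonneg hx, negPart_of_nonneg hx]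
  simp [conePosPart]

/-- The order of the dual: `φ ≤ ψ` if and only if `φ x ≤ ψ x` for all `x ≥ 0`. -/
instance instPartialOrderDual : PartialOrder (StrongDual ℝ E) where
  le φ ψ := ∀ x : E, 0 ≤ x → φ x ≤ ψ x
  le_refl φ x _ := le_rfl
  le_trans φ ψ χ h1 h2 x hx := (h1 x hx).trans (h2 x hx)
  le_antisymm φ ψ h1 h2 := by
    ext x
    rw [← posPart_sub_negPart x, map_sub, map_sub,
      le_antisymm (h1 _ (posPart_nonneg x)) (h2 _ (posPart_nonneg x)),
      le_antisymm (h1 _ (negPart_nonneg x)) (h2 _ (negPart_nonneg x))]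

theorem dual_le_def {φ ψ : StrongDual ℝ E} : φ ≤ ψ ↔ ∀ x : E, 0 ≤ x → φ x ≤ ψ x := Iff.rfl

instance instIsOrderedAddMonoidDual : IsOrderedAddMonoid (StrongDual ℝ E) where
  add_le_add_left φ ψ h χ x hx := by simpa using h x hx

theorem dualPosPart_nonneg (φ : StrongDual ℝ E) : 0 ≤ dualPosPart φ := fun x hx => by
  rw [dualPosPart_apply φ hx]; exact conePosPart_nonneg φ hx

theorem le_dualPosPart (φ : StrongDual ℝ E) : φ ≤ dualPosPart φ := fun x hx => by
  rw [dualPosPart_apply φ hx]; exact le_conePosPart φ hx le_rfl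

theorem dualPosPart_le {φ ψ : StrongDual ℝ E} (h : φ ≤ ψ) (h0 : 0 ≤ ψ) : dualPosPart φ ≤ ψ :=
  fun x hx => by
    rw [dualPosPart_apply φ hx]
    refine conePosPart_le φ hx fun z hz hzx => (h z hz).trans ?_
    have := h0 (x - z) (sub_nonneg.2 hzx)
    rw [map_sub] at this
    simpa using this

/-- The dual of a Banach lattice is a vector lattice for its natural order. -/
noncomputable instance instLatticeDual : Lattice (StrongDual ℝ E) where
  sup φ ψ := ψ + dualPosPart (φ - ψ)
  inf φ ψ := φ - dualPosPart (φ - ψ)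
  le_sup_left φ ψ := by
    simpa using add_le_add_right (le_dualPosPart (φ - ψ)) ψ
  le_sup_right φ ψ := le_add_of_nonneg_right (dualPosPart_nonneg _)
  sup_le φ ψ χ h1 h2 := by
    have := dualPosPart_le (φ := φ - ψ) (ψ := χ - ψ) (sub_le_sub_right h1 ψ) (sub_nonneg.2 h2)
    simpa using add_le_add_right this ψ
  inf_le_left φ ψ := sub_le_self _ (dualPosPart_nonneg _)
  inf_le_right φ ψ := by
    simpa using sub_le_sub_left (le_dualPosPart (φ - ψ)) φ
  le_inf χ φ ψ h1 h2 := by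
    have := dualPosPart_le (φ := φ - ψ) (ψ := φ - χ) (sub_le_sub_left h2 φ) (sub_nonneg.2 h1)
    simpa using sub_le_sub_left this φ

instance instIsOrderedModuleDual : IsOrderedModule ℝ (StrongDual ℝ E) :=
  IsOrderedModule.of_smul_nonneg (α := ℝ) (β := StrongDual ℝ E) fun a ha φ hφ =>
    dual_le_def.2 fun x hx => by
      simpa using mul_nonneg ha (dual_le_def.1 hφ x hx)

theorem abs_dual_apply_le (φ : StrongDual ℝ E) (x : E) : |φ x| ≤ |φ| |x| := by
  have h1 : ∀ y : E, 0 ≤ y → |φ y| ≤ |φ| y := fun y hy =>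
    abs_le'.2 ⟨le_abs_self φ y hy, neg_le_abs φ y hy⟩
  calc |φ x| = |φ x⁺ - φ x⁻| := by rw [← map_sub, posPart_sub_negPart]
    _ ≤ |φ x⁺| + |φ x⁻| := abs_sub _ _
    _ ≤ |φ| x⁺ + |φ| x⁻ := add_le_add (h1 _ (posPart_nonneg x)) (h1 _ (negPart_nonneg x))
    _ = |φ| |x| := by rw [← map_add, posPart_add_negPart]

theorem abs_dual_apply_le_norm (φ : StrongDual ℝ E) {x : E} (hx : 0 ≤ x) :
    |φ| x ≤ ‖φ‖ * ‖x‖ := by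
  have h : |φ| x = -φ x + conePosPart (φ - -φ) x := by
    rw [← dualPosPart_apply _ hx]; rfl
  have h2 : conePosPart (φ - -φ) x ≤ ‖φ‖ * ‖x‖ + φ x := by
    refine conePosPart_le _ hx fun z hz hzx => ?_
    have h3 : ‖z - (x - z)‖ ≤ ‖x‖ := by
      apply HasSolidNorm.solid
      rw [abs_of_nonneg hx, abs_le']
      have h4 : (0 : E) ≤ x - z := sub_nonneg.2 hzx
      exact ⟨(sub_le_self z h4).trans hzx, by
        rw [neg_sub]; exact (sub_le_self _ hz).trans (sub_le_self x hz)⟩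
    have h5 := (le_abs_self _).trans ((φ.le_opNorm (z - (x - z))).trans
      (mul_le_mul_of_nonneg_left h3 (norm_nonneg _)))
    simp only [map_sub] at h5
    simp only [sub_neg_eq_add, add_apply]
    linarith
  linarith

instance instHasSolidNormDual : HasSolidNorm (StrongDual ℝ E) where
  solid φ ψ h := by
    refine φ.opNorm_le_bound (norm_nonneg _) fun x => ?_
    calc ‖φ x‖ ≤ |φ| |x| := abs_dual_apply_le φ x
      _ ≤ |ψ| |x| := h _ (abs_nonneg x)
      _ ≤ ‖ψ‖ * ‖|x|‖ := abs_dual_apply_le_norm ψ (abs_nonneg x)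
      _ = ‖ψ‖ * ‖x‖ := by rw [norm_abs_eq_norm]

end Dual

/-- The bidual `E**`, with its order, lattice structure and norm as the dual of `E*`. -/
abbrev Bidual (E : Type*) [NormedAddCommGroup E] [NormedSpace ℝ E] : Type _ :=
  StrongDual ℝ (StrongDual ℝ E)

section OrderContinuity

/-- `y ↓ 0`: the net `y` is decreasing with infimum `0`. -/
def DecreasesToZero {Ω G : Type*} [Preorder Ω] [Preorder G] [Zero G] (y : Ω → G) : Prop :=
  Antitone y ∧ IsGLB (Set.range y) 0

/-- Order convergence of a net in a Riesz space: `|x α - a| ≤ y α` for a net `y ↓ 0`. -/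
def OrderTendsto {Ω G : Type*} [Preorder Ω] [Lattice G] [AddCommGroup G]
    (x : Ω → G) (a : G) : Prop :=
  ∃ y : Ω → G, DecreasesToZero y ∧ ∀ α, |x α - a| ≤ y α

universe w in
/-- Order continuity of a linear operator between Riesz spaces
(for nets indexed by directed sets in an arbitrary universe `w`). -/
def IsOrderContinuous {G H : Type*} [Lattice G] [AddCommGroup G] [Module ℝ G]
    [Lattice H] [AddCommGroup H] [Module ℝ H] (T : G →ₗ[ℝ] H) : Prop :=
  ∀ (Ω : Type w) [Preorder Ω] [IsDirectedOrder Ω] [Nonempty Ω] (x : Ω → G),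
    OrderTendsto x 0 → OrderTendsto (fun α => T (x α)) 0

universe w in
/-- Separate order continuity of a multilinear operator between Riesz spaces. -/
def IsSeparatelyOrderContinuous {ι : Type*} [DecidableEq ι] {G : ι → Type*} {H : Type*}
    [∀ j, Lattice (G j)] [∀ j, AddCommGroup (G j)] [∀ j, Module ℝ (G j)]
    [Lattice H] [AddCommGroup H] [Module ℝ H] (B : MultilinearMap ℝ G H) : Prop :=
  ∀ (j : ι) (x : ∀ k, G k), IsOrderContinuous.{w} (B.toLinearMap x j)

universe u in
/-- The norm of `G` is order continuous: `x ↓ 0` implies `‖x α‖ → 0`. Since a decreasing net is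
reindexed by its range, nets indexed in the universe of `G` suffice. -/
def HasOrderContinuousNorm (G : Type u) [NormedAddCommGroup G] [Lattice G] : Prop :=
  ∀ (Ω : Type u) [Preorder Ω] [IsDirectedOrder Ω] [Nonempty Ω] (x : Ω → G),
    DecreasesToZero x → Tendsto (fun α => ‖x α‖) atTop (𝓝 0)

end OrderContinuity

section Regular

/-- A linear operator is regular if it is the difference of two positive linear operators. -/
def IsRegularLinear {G H : Type*} [AddCommGroup G] [Module ℝ G] [Preorder G]
    [AddCommGroup H] [Module ℝ H] [Preorder H] (T : G →ₗ[ℝ] H) : Prop :=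
  ∃ T₁ T₂ : G →ₗ[ℝ] H, (∀ x, 0 ≤ x → 0 ≤ T₁ x) ∧ (∀ x, 0 ≤ x → 0 ≤ T₂ x) ∧ T = T₁ - T₂

/-- A multilinear operator is positive if it is nonnegative on tuples of positive elements. -/
def IsPositiveMultilinear {ι : Type*} {G : ι → Type*} {H : Type*}
    [∀ j, AddCommGroup (G j)] [∀ j, Module ℝ (G j)] [∀ j, Preorder (G j)]
    [AddCommGroup H] [Module ℝ H] [Preorder H] (A : MultilinearMap ℝ G H) : Prop :=
  ∀ x : ∀ j, G j, (∀ j, 0 ≤ x j) → 0 ≤ A x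

/-- A multilinear operator is regular if it is the difference of two positive ones. -/
def IsRegularMultilinear {ι : Type*} {G : ι → Type*} {H : Type*}
    [∀ j, AddCommGroup (G j)] [∀ j, Module ℝ (G j)] [∀ j, Preorder (G j)]
    [AddCommGroup H] [Module ℝ H] [Preorder H] (A : MultilinearMap ℝ G H) : Prop :=
  ∃ A₁ A₂ : MultilinearMap ℝ G H,
    IsPositiveMultilinear A₁ ∧ IsPositiveMultilinear A₂ ∧ A = A₁ - A₂

/-- A linear operator between Banach spaces is weakly compact if the image of the closed unit ball
is relatively compact for the weak topology of the range space. -/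
def IsWeaklyCompactOperator {G H : Type*} [NormedAddCommGroup G] [NormedSpace ℝ G]
    [NormedAddCommGroup H] [NormedSpace ℝ H] (T : G →ₗ[ℝ] H) : Prop :=
  IsCompact (closure (toWeakSpace ℝ H '' (T '' Metric.closedBall 0 1)))

variable {ι : Type*} [Fintype ι] {E : ι → Type*} {F : Type*}
  [∀ j, NormedAddCommGroup (E j)] [∀ j, NormedSpace ℝ (E j)] [∀ j, Lattice (E j)]
  [∀ j, IsOrderedAddMonoid (E j)] [∀ j, IsOrderedModule ℝ (E j)] [∀ j, HasSolidNorm (E j)]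
  [NormedAddCommGroup F] [NormedSpace ℝ F] [Lattice F] [IsOrderedAddMonoid F] [HasSolidNorm F]

theorem IsPositiveMultilinear.mono {A : MultilinearMap ℝ E F} (hA : IsPositiveMultilinear A)
    {x y : ∀ j, E j} (hx : ∀ j, 0 ≤ x j) (hxy : ∀ j, x j ≤ y j) : A x ≤ A y := by
  classical
  have h : y = x + (y - x) := by abel
  rw [h, A.map_add_univ]
  have h2 := Finset.single_le_sum (f := fun s : Finset ι => A (s.piecewise x (y - x)))
    (s := Finset.univ) (fun s _ => hA _ fun j => ?_) (Finset.mem_univ Finset.univ)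
  · simpa using h2
  · by_cases hj : j ∈ s
    · simpa [hj] using hx j
    · simpa [hj] using hxy j

theorem IsPositiveMultilinear.exists_bound_cone [∀ j, CompleteSpace (E j)]
    {A : MultilinearMap ℝ E F} (hA : IsPositiveMultilinear A) :
    ∃ C : ℝ, 0 ≤ C ∧ ∀ x : ∀ j, E j, (∀ j, 0 ≤ x j) → ‖A x‖ ≤ C * ∏ j, ‖x j‖ := by
  by_contra! hcon
  have h1 : ∀ n : ℕ, ∃ x : ∀ j, E j, (∀ j, 0 ≤ x j) ∧
      ((n : ℝ) * ∏ _j : ι, (2 : ℝ) ^ n) * ∏ j, ‖x j‖ < ‖A x‖ := fun n =>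
    hcon ((n : ℝ) * ∏ _j : ι, (2 : ℝ) ^ n) (by positivity)
  choose x hx hAx using h1
  have hne : ∀ n j, 0 < ‖x n j‖ := by
    intro n j
    rw [norm_pos_iff]
    intro h0
    have h2 := hAx n
    rw [A.map_coord_zero j h0, norm_zero] at h2
    exact absurd h2 (not_lt.2 (by positivity))
  let c : ℕ → ι → ℝ := fun n j => (2 ^ n * ‖x n j‖)⁻¹
  have hc : ∀ n j, 0 ≤ c n j := fun n j => by positivity
  let u : ℕ → ∀ j, E j := fun n j => c n j • x n j
  have hu : ∀ n j, 0 ≤ u n j := fun n j => smul_nonneg (hc n j) (hx n j)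
  have hun : ∀ n j, ‖u n j‖ = (1 / 2 : ℝ) ^ n := by
    intro n j
    have := (hne n j).ne'
    simp only [u, c, norm_smul, Real.norm_eq_abs, abs_of_nonneg (hc n j)]
    rw [one_div, inv_pow]
    field_simp
  have hsum : ∀ j, Summable fun n => u n j := fun j =>
    Summable.of_norm (by simpa only [hun] using summable_geometric_two)
  let v : ∀ j, E j := fun j => ∑' n, u n j
  have huv : ∀ n j, u n j ≤ v j := fun n j =>
    le_hasSum (hsum j).hasSum n fun k _ => hu k j
  obtain ⟨n, hn⟩ := exists_nat_gt ‖A v‖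
  have h3 : ‖A (u n)‖ ≤ ‖A v‖ :=
    norm_le_of_nonneg_of_le (hA _ (hu n)) (hA.mono (hu n) (huv n))
  have h4 : A (u n) = (∏ j, c n j) • A (x n) := A.map_smul_univ (c n) (x n)
  have hpos : 0 < ∏ j, (2 ^ n * ‖x n j‖) :=
    Finset.prod_pos fun j _ => mul_pos (by positivity) (hne n j)
  have h5 : (n : ℝ) < ‖A (u n)‖ := by
    rw [h4, norm_smul, Real.norm_eq_abs,
      abs_of_nonneg (Finset.prod_nonneg fun j _ => hc n j)]
    simp only [c, Finset.prod_inv_distrib]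
    rw [inv_mul_eq_div, lt_div_iff₀ hpos, Finset.prod_mul_distrib, ← mul_assoc]
    exact hAx n
  linarith

/-- A regular multilinear operator between Banach lattices is automatically continuous. -/
theorem IsRegularMultilinear.continuous [∀ j, CompleteSpace (E j)]
    {A : MultilinearMap ℝ E F} (hA : IsRegularMultilinear A) : Continuous A := by
  classical
  have key : ∀ B : MultilinearMap ℝ E F, IsPositiveMultilinear B → Continuous B := by
    intro B hB
    obtain ⟨C, hC, hbound⟩ := hB.exists_bound_cone
    refine B.continuous_of_bound (∑ _s : Finset ι, C) fun x => ?_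
    have hx : x = (fun j => (-1 : ℝ) • (x j)⁻) + fun j => (x j)⁺ := by
      ext j
      have := posPart_sub_negPart (x j)
      simp only [Pi.add_apply, neg_smul, one_smul]
      rw [← sub_eq_neg_add, this]
    conv_lhs => rw [hx, B.map_add_univ]
    rw [Finset.sum_mul]
    refine (norm_sum_le _ _).trans (Finset.sum_le_sum fun s _ => ?_)
    have h1 : s.piecewise (fun j => (-1 : ℝ) • (x j)⁻) (fun j => (x j)⁺) =
        s.piecewise
          (fun j => (-1 : ℝ) • (s.piecewise (fun j => (x j)⁻) (fun j => (x j)⁺) : ∀ j, E j) j)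
          (s.piecewise (fun j => (x j)⁻) (fun j => (x j)⁺)) := by
      ext j
      by_cases hj : j ∈ s <;> simp [hj]
    rw [h1, B.map_piecewise_smul (fun _ => (-1 : ℝ)), norm_smul]
    have h2 : ‖∏ _j ∈ s, (-1 : ℝ)‖ = 1 := by simp
    rw [h2, one_mul]
    refine (hbound _ fun j => ?_).trans (mul_le_mul_of_nonneg_left
      (Finset.prod_le_prod (fun _ _ => norm_nonneg _) fun j _ => ?_) hC)
    · by_cases hj : j ∈ s
      · simp [hj]
      · simp [hj]
    · by_cases hj : j ∈ s
      · simpa [hj] using norm_negPart_le (x j)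
      · simpa [hj] using norm_posPart_le (x j)
  obtain ⟨A₁, A₂, h₁, h₂, rfl⟩ := hA
  exact (key A₁ h₁).sub (key A₂ h₂)

/-- A regular multilinear operator between Banach lattices, as a continuous multilinear map. -/
def IsRegularMultilinear.toContinuous [∀ j, CompleteSpace (E j)]
    {A : MultilinearMap ℝ E F} (hA : IsRegularMultilinear A) : ContinuousMultilinearMap ℝ E F where
  toMultilinearMap := A
  cont := hA.continuous

end Regular

section Arens

universe u v

/-- For `ξ ∈ E_{n+1}**`, the operator sending an `(n+1)`-linear form `B` to the `n`-linear form
`(x_1, …, x_n) ↦ ξ (B (x_1, …, x_n, •))`. -/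
noncomputable def applyLast {n : ℕ} {E : Fin (n + 1) → Type u} [∀ j, NormedAddCommGroup (E j)]
    [∀ j, NormedSpace ℝ (E j)] (ξ : Bidual (E (Fin.last n))) :
    ContinuousMultilinearMap ℝ E ℝ →L[ℝ]
      ContinuousMultilinearMap ℝ (fun j : Fin n => E j.castSucc) ℝ :=
  (ContinuousLinearMap.compContinuousMultilinearMapL ℝ (fun j : Fin n => E j.castSucc)
      (StrongDual ℝ (E (Fin.last n))) ℝ ξ) ∘L
    (continuousMultilinearCurryRightEquiv ℝ E ℝ).toContinuousLinearEquiv.toContinuousLinearMap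

/-- The composition `applyLast ξ₁ ∘ ⋯ ∘ applyLast ξ_m`, a functional on the space of `m`-linear
forms: the bidual elements act on a form successively, from the last variable to the first. -/
noncomputable def arensFunctional : {m : ℕ} → {E : Fin m → Type u} →
    [∀ j, NormedAddCommGroup (E j)] → [∀ j, NormedSpace ℝ (E j)] →
    (∀ j, Bidual (E j)) → (ContinuousMultilinearMap ℝ E ℝ →L[ℝ] ℝ)
  | 0, E, _, _, _ => ContinuousMultilinearMap.apply ℝ E ℝ (fun j => j.elim0)
  | n + 1, _, _, _, ξ =>
      (arensFunctional (fun j : Fin n => ξ j.castSucc)) ∘L (applyLast (ξ (Fin.last n)))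

theorem applyLast_apply {n : ℕ} {E : Fin (n + 1) → Type u} [∀ j, NormedAddCommGroup (E j)]
    [∀ j, NormedSpace ℝ (E j)] (ξ : Bidual (E (Fin.last n))) (B : ContinuousMultilinearMap ℝ E ℝ)
    (x : ∀ j : Fin n, E j.castSucc) : applyLast ξ B x = ξ (B.curryRight x) := rfl

theorem applyLast_add {n : ℕ} {E : Fin (n + 1) → Type u} [∀ j, NormedAddCommGroup (E j)]
    [∀ j, NormedSpace ℝ (E j)] (ξ η : Bidual (E (Fin.last n))) :
    applyLast (ξ + η) = applyLast ξ + applyLast η := rfl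

theorem applyLast_smul {n : ℕ} {E : Fin (n + 1) → Type u} [∀ j, NormedAddCommGroup (E j)]
    [∀ j, NormedSpace ℝ (E j)] (c : ℝ) (ξ : Bidual (E (Fin.last n))) :
    applyLast (c • ξ) = c • applyLast ξ := rfl

theorem arensFunctional_succ {n : ℕ} {E : Fin (n + 1) → Type u} [∀ j, NormedAddCommGroup (E j)]
    [∀ j, NormedSpace ℝ (E j)] (ξ : ∀ j, Bidual (E j)) :
    arensFunctional ξ = (arensFunctional (fun j : Fin n => ξ j.castSucc)) ∘L
      (applyLast (ξ (Fin.last n))) := rfl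

theorem arensFunctional_update_last {n : ℕ} {E : Fin (n + 1) → Type u}
    [∀ j, NormedAddCommGroup (E j)] [∀ j, NormedSpace ℝ (E j)] (ξ : ∀ j, Bidual (E j))
    (η : Bidual (E (Fin.last n))) :
    arensFunctional (Function.update ξ (Fin.last n) η) =
      (arensFunctional (fun j : Fin n => ξ j.castSucc)) ∘L (applyLast η) := by
  rw [arensFunctional_succ, Function.update_self]
  congr 2
  ext1 j
  exact Function.update_of_ne (Fin.castSucc_lt_last j).ne _ _

theorem arensFunctional_update_castSucc {n : ℕ} {E : Fin (n + 1) → Type u}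
    [∀ j, NormedAddCommGroup (E j)] [∀ j, NormedSpace ℝ (E j)] (ξ : ∀ j, Bidual (E j))
    (i : Fin n) (η : Bidual (E i.castSucc)) :
    arensFunctional (Function.update ξ i.castSucc η) =
      (arensFunctional (Function.update (fun j : Fin n => ξ j.castSucc) i η)) ∘L
        (applyLast (ξ (Fin.last n))) := by
  rw [arensFunctional_succ, Function.update_of_ne (Fin.castSucc_lt_last i).ne']
  congr 2
  ext1 j
  by_cases h : j = i
  · subst h; simp
  · rw [Function.update_of_ne h, Function.update_of_ne (by simpa using h)]

theorem arensFunctional_update_add : ∀ {m : ℕ} {E : Fin m → Type u}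
    [∀ j, NormedAddCommGroup (E j)] [∀ j, NormedSpace ℝ (E j)] (ξ : ∀ j, Bidual (E j))
    (i : Fin m) (η ζ : Bidual (E i)),
    arensFunctional (Function.update ξ i (η + ζ)) =
      arensFunctional (Function.update ξ i η) + arensFunctional (Function.update ξ i ζ)
  | 0, _, _, _, _, i, _, _ => i.elim0
  | n + 1, E, _, _, ξ, i, η, ζ => by
    induction i using Fin.lastCases with
    | last =>
      simp only [arensFunctional_update_last, applyLast_add, ContinuousLinearMap.comp_add]
    | cast i =>
      simp only [arensFunctional_update_castSucc, ← ContinuousLinearMap.add_comp]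
      rw [arensFunctional_update_add]

theorem arensFunctional_update_smul : ∀ {m : ℕ} {E : Fin m → Type u}
    [∀ j, NormedAddCommGroup (E j)] [∀ j, NormedSpace ℝ (E j)] (ξ : ∀ j, Bidual (E j))
    (i : Fin m) (c : ℝ) (η : Bidual (E i)),
    arensFunctional (Function.update ξ i (c • η)) = c • arensFunctional (Function.update ξ i η)
  | 0, _, _, _, _, i, _, _ => i.elim0
  | n + 1, E, _, _, ξ, i, c, η => by
    induction i using Fin.lastCases with
    | last =>
      simp only [arensFunctional_update_last, applyLast_smul, ContinuousLinearMap.comp_smul]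
    | cast i =>
      simp only [arensFunctional_update_castSucc, ← ContinuousLinearMap.smul_comp]
      rw [arensFunctional_update_smul]

/-- The Arens extension `A^{*[m+1]} : E_1** × ⋯ × E_m** → F**` of a continuous `m`-linear operator
`A`, given by `A^{*[m+1]}(ξ)(y*) = (applyLast ξ₁ ∘ ⋯ ∘ applyLast ξ_m)(y* ∘ A)`. -/
noncomputable def arensExtension {m : ℕ} {E : Fin m → Type u} {F : Type v}
    [∀ j, NormedAddCommGroup (E j)] [∀ j, NormedSpace ℝ (E j)]
    [NormedAddCommGroup F] [NormedSpace ℝ F] (A : ContinuousMultilinearMap ℝ E F) :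
    MultilinearMap ℝ (fun j => Bidual (E j)) (Bidual F) where
  toFun ξ := (arensFunctional ξ) ∘L
    ((ContinuousLinearMap.compContinuousMultilinearMapL ℝ E F ℝ).flip A)
  map_update_add' {inst} ξ i η ζ := by
    cases Subsingleton.elim inst (instDecidableEqFin m)
    rw [arensFunctional_update_add, ContinuousLinearMap.add_comp]
  map_update_smul' {inst} ξ i c η := by
    cases Subsingleton.elim inst (instDecidableEqFin m)
    rw [arensFunctional_update_smul, ContinuousLinearMap.smul_comp]

end Arens

end BanachLattice

universe u v w

namespace BanachLattice

/-! Writing the regular operator as a difference of positive ones and using `|B x| ≤ B |x|` leaves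
one claim: for positive `A`, positive fixed arguments `ξ` and a net `η α ↓ 0` in slot `i`, the
values of the Arens extension decrease to `0` in `F**`. In a dual, a decreasing positive net has
infimum `0` exactly when it tends to `0` pointwise on the cone, so it is enough to treat the scalar
nets obtained from a positive form `B = φ ∘ A`.

The slots after `i` act on `B` first and merely replace it by a positive form in fewer variables, so
`η α` may be taken to act in the last slot. Currying that slot turns `B` into an operator `D` with
values in `E_i*`, on which `η α` acts by composition. Weak compactness of the regular operators `E_j
→ E_i*` means that their second adjoints stay in `E_i*`; this lets `η α` be moved past every `ξ_j`
except that of the first slot (`applyLast_comp_eq`). What remains is `ξ_1 (η α ∘ T)` for a positive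
`T : E_1 → E_i*`. Here `η α ∘ T ↓ 0` in `E_1*`, hence in norm, and continuity of `ξ_1` finishes
(`tendsto_arensFunctional_comp`). The first slot is never interchanged with another, which is why
the operators on `E_1` need not be weakly compact. -/

theorem IsPositiveMultilinear.abs_apply_le {ι : Type*} [Fintype ι] {G : ι → Type*} {H : Type*}
    [∀ j, Lattice (G j)] [∀ j, AddCommGroup (G j)] [∀ j, IsOrderedAddMonoid (G j)]
    [∀ j, Module ℝ (G j)] [Lattice H] [AddCommGroup H] [IsOrderedAddMonoid H] [Module ℝ H]
    {B : MultilinearMap ℝ G H} (hB : IsPositiveMultilinear B) (x : ∀ j, G j) :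
    |B x| ≤ B fun j => |x j| := by
  classical
  have habs : (fun j => |x j|) = (fun j => (x j)⁻) + fun j => (x j)⁺ := by
    ext j
    rw [Pi.add_apply, add_comm, posPart_add_negPart]
  have hx : x = (fun j => (-1 : ℝ) • (x j)⁻) + fun j => (x j)⁺ := by
    ext j
    rw [Pi.add_apply, neg_smul, one_smul, ← sub_eq_neg_add, posPart_sub_negPart]
  rw [habs]
  conv_lhs => rw [hx]
  rw [B.map_add_univ, B.map_add_univ]
  -- Both sides are now sums over the same subsets `s`; corresponding terms differ only by the sign
  -- `(-1) ^ s.card`.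
  refine (Finset.le_sum_of_subadditive _ abs_zero.le abs_add_le _ _).trans
    (Finset.sum_le_sum fun s _ => ?_)
  have h1 : s.piecewise (fun j => (-1 : ℝ) • (x j)⁻) (fun j => (x j)⁺) =
      s.piecewise
        (fun j => (-1 : ℝ) • (s.piecewise (fun j => (x j)⁻) (fun j => (x j)⁺) : ∀ j, G j) j)
        (s.piecewise (fun j => (x j)⁻) (fun j => (x j)⁺)) := by
    ext j
    by_cases hj : j ∈ s <;> simp [hj]
  have h2 : 0 ≤ B (s.piecewise (fun j => (x j)⁻) fun j => (x j)⁺) := hB _ fun j => by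
    by_cases hj : j ∈ s <;> simp [hj, negPart_nonneg, posPart_nonneg]
  rw [h1, B.map_piecewise_smul (fun _ => (-1 : ℝ)), Finset.prod_const]
  rcases neg_one_pow_eq_or ℝ s.card with h | h
  · rw [h, one_smul, abs_of_nonneg h2]
  · rw [h, neg_smul, one_smul, abs_neg, abs_of_nonneg h2]

/-! ### Decreasing nets in a dual: order versus pointwise convergence -/

section Dual

variable {G : Type*} [NormedAddCommGroup G] [NormedSpace ℝ G] [Lattice G] [IsOrderedAddMonoid G]
  [HasSolidNorm G]

/-- A decreasing net of functionals with infimum `0` tends to `0` pointwise. -/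
theorem DecreasesToZero.tendsto_apply {Ω : Type*} [Preorder Ω] [IsDirectedOrder Ω] [Nonempty Ω]
    {φ : Ω → StrongDual ℝ G} (hφ : DecreasesToZero φ) (x : G) :
    Tendsto (fun α => φ α x) atTop (𝓝 0) := by
  have hnonneg : ∀ α, 0 ≤ φ α := fun α => hφ.2.1 ⟨α, rfl⟩
  have hcone : ∀ y : G, 0 ≤ y → Tendsto (fun α => φ α y) atTop (𝓝 (⨅ α, φ α y)) := fun y hy =>
    tendsto_atTop_ciInf (fun α β h => hφ.1 h y hy)
      ⟨0, by rintro _ ⟨α, rfl⟩; exact hnonneg α y hy⟩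
  let l : G → ℝ := fun y => (⨅ α, φ α y⁺) - ⨅ α, φ α y⁻
  have hl : ∀ y, Tendsto (fun α => φ α y) atTop (𝓝 (l y)) := fun y => by
    simpa only [← map_sub, posPart_sub_negPart] using
      (hcone _ (posPart_nonneg y)).sub (hcone _ (negPart_nonneg y))
  let L : G →ₗ[ℝ] ℝ := linearMapOfTendsto l (fun α => (φ α : G →ₗ[ℝ] ℝ)) (tendsto_pi_nhds.2 hl)
  obtain ⟨α₀⟩ := ‹Nonempty Ω›
  -- Past `α₀` one has `0 ≤ φ α ≤ φ α₀`, so solidity of the dual norm bounds the tail uniformly and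
  -- the pointwise limit is a continuous functional.
  let ψ : StrongDual ℝ G := L.mkContinuous ‖φ α₀‖ fun y => by
    refine le_of_tendsto (hl y).norm ?_
    filter_upwards [eventually_ge_atTop α₀] with α hα
    exact ((φ α).le_opNorm y).trans (mul_le_mul_of_nonneg_right
      (norm_le_of_nonneg_of_le (hnonneg α) (hφ.1 hα)) (norm_nonneg y))
  -- The pointwise limit is a lower bound of the net, and `0` is the greatest one.
  have hψ : ψ ≤ 0 := hφ.2.2 <| by
    rintro _ ⟨α, rfl⟩ y hy
    refine le_of_tendsto (hl y) ?_
    filter_upwards [eventually_ge_atTop α] with β hβ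
    exact hφ.1 hβ y hy
  have hψ' : 0 ≤ ψ := fun y hy => ge_of_tendsto' (hl y) fun α => hnonneg α y hy
  have h0 : l x = 0 := congrArg (fun θ : StrongDual ℝ G => θ x) (le_antisymm hψ hψ')
  simpa only [h0] using hl x

/-- Any lower bound of the net is dominated on the cone by the pointwise limit `0`. This is the
converse of `DecreasesToZero.tendsto_apply`. -/
theorem decreasesToZero_of_tendsto_apply {Ω : Type*} [Preorder Ω] [IsDirectedOrder Ω] [Nonempty Ω]
    {φ : Ω → StrongDual ℝ G} (hanti : Antitone φ) (hnonneg : ∀ α, 0 ≤ φ α)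
    (h : ∀ x, 0 ≤ x → Tendsto (fun α => φ α x) atTop (𝓝 0)) : DecreasesToZero φ := by
  refine ⟨hanti, ?_, fun ψ hψ x hx => ge_of_tendsto' (h x hx) fun α => hψ ⟨α, rfl⟩ x hx⟩
  rintro _ ⟨α, rfl⟩
  exact hnonneg α

end Dual

/-- Frees the index set from the universe of `G`: a decreasing net factors through its range with
the reversed order, which is directed and lives in the universe of `G`. -/
theorem HasOrderContinuousNorm.tendsto_norm {G : Type*} [NormedAddCommGroup G] [Lattice G]
    (hG : HasOrderContinuousNorm G) {Ω : Type*} [Preorder Ω] [IsDirectedOrder Ω] [Nonempty Ω]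
    {x : Ω → G} (hx : DecreasesToZero x) : Tendsto (fun α => ‖x α‖) atTop (𝓝 0) := by
  have hdir : IsDirectedOrder (Set.range x)ᵒᵈ := by
    refine ⟨?_⟩
    rintro ⟨_, α, rfl⟩ ⟨_, β, rfl⟩
    obtain ⟨γ, hα, hβ⟩ := exists_ge_ge α β
    exact ⟨OrderDual.toDual ⟨x γ, γ, rfl⟩, hx.1 hα, hx.1 hβ⟩
  have hne : Nonempty (Set.range x)ᵒᵈ := ⟨OrderDual.toDual ⟨_, Classical.arbitrary Ω, rfl⟩⟩
  have h := hG (Set.range x)ᵒᵈ (fun s => ((OrderDual.ofDual s).1 : G)) ⟨fun s t hst => hst, by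
    have : Set.range (fun s : (Set.range x)ᵒᵈ => ((OrderDual.ofDual s).1 : G)) = Set.range x :=
      Subtype.range_coe
    rw [this]; exact hx.2⟩
  refine h.comp (tendsto_atTop_atTop.2 ?_ : Tendsto
    (fun α => OrderDual.toDual (⟨x α, α, rfl⟩ : Set.range x)) atTop atTop)
  rintro ⟨_, α, rfl⟩
  exact ⟨α, fun β hβ => hx.1 hβ⟩

/-! ### Second adjoints of weakly compact operators -/

section WeaklyCompact

variable {G H : Type*} [NormedAddCommGroup G] [NormedSpace ℝ G]
  [NormedAddCommGroup H] [NormedSpace ℝ H]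

/-- A Goldstine-type argument: finitely many functionals map the weakly compact convex set `W` onto
a closed convex set in `ℝ^k`. If the prescribed values lay outside it, a separating combination `θ`
would satisfy `‖θ ∘ T‖ ≤ u < ξ (θ ∘ T)`, against `‖ξ‖ ≤ 1`. -/
theorem exists_mem_closure_forall_apply_eq {T : G →L[ℝ] H}
    (hT : IsWeaklyCompactOperator T.toLinearMap)
    {ξ : Bidual G} (hξ : ‖ξ‖ ≤ 1) {k : ℕ} (η : Fin k → StrongDual ℝ H) :
    ∃ y ∈ closure (toWeakSpace ℝ H '' (T.toLinearMap '' Metric.closedBall 0 1)),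
      ∀ i, η i ((toWeakSpace ℝ H).symm y) = ξ (η i ∘L T) := by
  let W := closure (toWeakSpace ℝ H '' (T.toLinearMap '' Metric.closedBall 0 1))
  let e : WeakSpace ℝ H →ₗ[ℝ] (Fin k → ℝ) :=
    LinearMap.pi fun i => (η i).toLinearMap ∘ₗ (toWeakSpace ℝ H).symm.toLinearMap
  have hcont : Continuous e :=
    continuous_pi fun i => WeakBilin.eval_continuous (topDualPairing ℝ H).flip (η i)
  have hconv : Convex ℝ (e '' W) := by
    refine Convex.linear_image (Convex.closure ?_) e
    exact ((convex_closedBall 0 1).linear_image _).linear_image (toWeakSpace ℝ H).toLinearMap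
  by_contra! hcon
  have hz : (fun i => ξ (η i ∘L T)) ∉ e '' W := by
    rintro ⟨y, hy, hyz⟩
    obtain ⟨i, hi⟩ := hcon y hy
    exact hi (congrFun hyz i)
  obtain ⟨f, u, hfu, huf⟩ := geometric_hahn_banach_closed_point hconv
    (IsCompact.image hT hcont).isClosed hz
  let c : Fin k → ℝ := fun i => f (Pi.single i 1)
  have hf : ∀ v : Fin k → ℝ, f v = ∑ i, c i * v i := fun v => by
    conv_lhs => rw [pi_eq_sum_univ' v]
    simp [c, mul_comm]
  let θ : StrongDual ℝ H := ∑ i, c i • η i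
  have hθ : ∀ x : G, ‖x‖ ≤ 1 → θ (T x) < u := fun x hx => by
    have h := hfu _ ⟨toWeakSpace ℝ H (T x),
      subset_closure ⟨T x, ⟨x, mem_closedBall_zero_iff.2 hx, rfl⟩, rfl⟩, rfl⟩
    rw [hf] at h
    simpa [θ, e] using h
  have hu : 0 ≤ u := by simpa using (hθ 0 (by simp)).le
  have hnorm : ‖θ ∘L T‖ ≤ u := by
    refine ContinuousLinearMap.opNorm_le_of_unit_norm hu fun x hx => ?_
    have h := hθ (-x) (by rw [norm_neg, hx])
    rw [map_neg, map_neg] at h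
    exact abs_le.2 ⟨by simpa using (neg_lt.1 h).le, (hθ x hx.le).le⟩
  have hξθ : ξ (θ ∘L T) = ∑ i, c i * ξ (η i ∘L T) := by
    have : θ ∘L T = ∑ i, c i • (η i ∘L T) := by ext x; simp [θ]
    rw [this, map_sum]
    simp
  rw [hf, ← hξθ] at huf
  have h := ((le_abs_self _).trans (ξ.le_of_opNorm_le hξ (θ ∘L T)))
  linarith

/-- The second adjoint of a weakly compact operator takes its values in the range space. -/
theorem IsWeaklyCompactOperator.exists_apply_eq {T : G →L[ℝ] H}
    (hT : IsWeaklyCompactOperator T.toLinearMap) (ξ : Bidual G) :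
    ∃ y : H, ∀ η : StrongDual ℝ H, η y = ξ (η ∘L T) := by
  wlog hξ : ‖ξ‖ ≤ 1 generalizing ξ
  · have hpos : 0 < ‖ξ‖ := zero_lt_one.trans (not_le.1 hξ)
    obtain ⟨y, hy⟩ := this (‖ξ‖⁻¹ • ξ) <|
      ContinuousLinearMap.opNorm_le_bound _ zero_le_one fun φ => by
        rw [one_mul, smul_apply, norm_smul, norm_inv, Real.norm_of_nonneg hpos.le,
          inv_mul_le_iff₀ hpos]
        exact ξ.le_opNorm φ
    refine ⟨‖ξ‖ • y, fun η => ?_⟩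
    rw [map_smul, hy]
    simp [hpos.ne']
  let W := closure (toWeakSpace ℝ H '' (T.toLinearMap '' Metric.closedBall 0 1))
  have hcont (η : StrongDual ℝ H) : Continuous fun y => η ((toWeakSpace ℝ H).symm y) :=
    WeakBilin.eval_continuous (topDualPairing ℝ H).flip η
  -- Finite intersection property: each condition on `η` is weakly closed, and any finitely many
  -- hold together somewhere in `W`.
  obtain ⟨y, -, hy⟩ := IsCompact.inter_iInter_nonempty hT
    (fun η : StrongDual ℝ H => {y | η ((toWeakSpace ℝ H).symm y) = ξ (η ∘L T)})
    (fun η => isClosed_eq (hcont η) continuous_const) fun s => by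
      obtain ⟨y, hyW, hy⟩ := exists_mem_closure_forall_apply_eq hT hξ
        (fun i => ((s.equivFin.symm i : s) : StrongDual ℝ H))
      refine ⟨y, hyW, Set.mem_iInter₂.2 fun η hη => ?_⟩
      simpa using hy (s.equivFin ⟨η, hη⟩)
  exact ⟨(toWeakSpace ℝ H).symm y, fun η => Set.mem_iInter.1 hy η⟩

end WeaklyCompact

theorem abs_sub_le_add {G : Type*} [Lattice G] [AddCommGroup G] [IsOrderedAddMonoid G]
    {a b c d : G} (hac : |a| ≤ c) (hbd : |b| ≤ d) : |a - b| ≤ c + d := by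
  rw [sub_eq_add_neg]
  exact (abs_add_le _ _).trans (add_le_add hac ((abs_neg b).le.trans hbd))

/-! ### Interchanging the last two variables -/

section ApplyLast

variable {n : ℕ} {E : Fin (n + 1) → Type u} [∀ j, NormedAddCommGroup (E j)]
  [∀ j, NormedSpace ℝ (E j)] [∀ j, Lattice (E j)] [∀ j, IsOrderedAddMonoid (E j)]
  [∀ j, HasSolidNorm (E j)] {H : Type v} [NormedAddCommGroup H] [NormedSpace ℝ H] [Lattice H]
  [IsOrderedAddMonoid H] [HasSolidNorm H]

/-- For `ξ ∈ E_{n+1}**`, the operator sending an `H*`-valued `(n+1)`-linear operator `D` to the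
`n`-linear operator `(x_1, …, x_n) ↦ (h ↦ ξ (D (x_1, …, x_n, •) h))`. -/
noncomputable def applyLastDual (ξ : Bidual (E (Fin.last n)))
    (D : ContinuousMultilinearMap ℝ E (StrongDual ℝ H)) :
    ContinuousMultilinearMap ℝ (fun j : Fin n => E j.castSucc) (StrongDual ℝ H) :=
  (ContinuousLinearMap.compL ℝ H (StrongDual ℝ (E (Fin.last n))) ℝ ξ ∘L
    (ContinuousLinearMap.flipₗᵢ ℝ (E (Fin.last n)) H ℝ).toContinuousLinearEquiv.toContinuousLinearMap
    ).compContinuousMultilinearMap D.curryRight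

theorem curryRight_apply_nonneg {F : Type*} [NormedAddCommGroup F] [NormedSpace ℝ F] [Preorder F]
    {D : ContinuousMultilinearMap ℝ E F} (hD : IsPositiveMultilinear D.toMultilinearMap)
    {x : ∀ j : Fin n, E j.castSucc} (hx : ∀ j, 0 ≤ x j) {y : E (Fin.last n)} (hy : 0 ≤ y) :
    0 ≤ D.curryRight x y :=
  hD (Fin.snoc x y) fun j => by
    induction j using Fin.lastCases with
    | last => simpa using hy
    | cast i => simpa using hx i

theorem isPositiveMultilinear_applyLast {ξ : Bidual (E (Fin.last n))} (hξ : 0 ≤ ξ)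
    {B : ContinuousMultilinearMap ℝ E ℝ} (hB : IsPositiveMultilinear B.toMultilinearMap) :
    IsPositiveMultilinear (applyLast ξ B).toMultilinearMap := fun x hx =>
  hξ (B.curryRight x) fun _ hy => curryRight_apply_nonneg hB hx hy

theorem isPositiveMultilinear_applyLastDual {ξ : Bidual (E (Fin.last n))} (hξ : 0 ≤ ξ)
    {D : ContinuousMultilinearMap ℝ E (StrongDual ℝ H)}
    (hD : IsPositiveMultilinear D.toMultilinearMap) :
    IsPositiveMultilinear (applyLastDual ξ D).toMultilinearMap := fun _ hx h hh =>
  hξ _ fun _ hy => curryRight_apply_nonneg hD hx hy h hh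

/-- The difference vanishes on the cone, so it is a positive form and `|(B - C) x| ≤ (B - C) |x| =
0`. Restricting to positive arguments is what makes the curried operator in `applyLast_comp_eq`
positive, hence regular. -/
theorem ext_of_nonneg {n : ℕ} {E : Fin n → Type u} [∀ j, NormedAddCommGroup (E j)]
    [∀ j, NormedSpace ℝ (E j)] [∀ j, Lattice (E j)] [∀ j, IsOrderedAddMonoid (E j)]
    {B C : ContinuousMultilinearMap ℝ E ℝ}
    (h : ∀ x, (∀ j, 0 ≤ x j) → B x = C x) : B = C := by
  have h0 : ∀ x, (∀ j, 0 ≤ x j) → (B - C) x = 0 := fun x hx => sub_eq_zero.2 (h x hx)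
  have hpos : IsPositiveMultilinear (B - C).toMultilinearMap := fun x hx => (h0 x hx).ge
  ext x
  have h1 := hpos.abs_apply_le x
  exact sub_eq_zero.1 (abs_nonpos_iff.1 (h1.trans_eq (h0 _ fun j => abs_nonneg (x j))))

/-- The Arens extensions may be taken in either order in the last two variables if the regular
operators between them are weakly compact. -/
theorem applyLast_comp_eq (hweak : ∀ T : E (Fin.last n) →ₗ[ℝ] StrongDual ℝ H,
      IsRegularLinear T → IsWeaklyCompactOperator T)
    (ξ : Bidual (E (Fin.last n))) {D : ContinuousMultilinearMap ℝ E (StrongDual ℝ H)}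
    (hD : IsPositiveMultilinear D.toMultilinearMap) (η : Bidual H) :
    applyLast ξ (η.compContinuousMultilinearMap D) =
      η.compContinuousMultilinearMap (applyLastDual ξ D) := by
  refine ext_of_nonneg (E := fun j : Fin n => E j.castSucc) fun x hx => ?_
  let T : E (Fin.last n) →L[ℝ] StrongDual ℝ H := D.curryRight x
  have hT : IsRegularLinear T.toLinearMap :=
    ⟨T.toLinearMap, 0, fun _ hy => curryRight_apply_nonneg hD hx hy, fun _ _ => le_rfl,
      LinearMap.ext fun _ => (sub_zero _).symm⟩
  obtain ⟨y, hy⟩ := (hweak _ hT).exists_apply_eq ξ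
  -- The element `y` represents the second adjoint of `T` at `ξ`; testing it on the evaluations at
  -- points of `H` identifies it.
  have hDy : applyLastDual ξ D x = y := by
    ext h
    exact (hy (ContinuousLinearMap.apply ℝ ℝ h)).symm
  calc applyLast ξ (η.compContinuousMultilinearMap D) x = ξ (η ∘L T) := rfl
    _ = η y := (hy η).symm
    _ = η (applyLastDual ξ D x) := by rw [hDy]

end ApplyLast

/-! ### Positivity and order continuity on scalar forms -/

theorem arensFunctional_nonneg : ∀ {m : ℕ} {E : Fin m → Type u}
    [∀ j, NormedAddCommGroup (E j)] [∀ j, NormedSpace ℝ (E j)] [∀ j, Lattice (E j)]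
    [∀ j, IsOrderedAddMonoid (E j)] [∀ j, HasSolidNorm (E j)]
    {ξ : ∀ j, Bidual (E j)} (_ : ∀ j, 0 ≤ ξ j) {B : ContinuousMultilinearMap ℝ E ℝ}
    (_ : IsPositiveMultilinear B.toMultilinearMap), 0 ≤ arensFunctional ξ B
  | 0, _, _, _, _, _, _, _, _, _, hB => hB _ fun j => j.elim0
  | _ + 1, _, _, _, _, _, _, _, hξ, _, hB =>
    arensFunctional_nonneg (fun j => hξ j.castSucc) (isPositiveMultilinear_applyLast (hξ _) hB)

/-- Each interchange absorbs the last `ξ` into `D`, giving a positive `H*`-valued operator in one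
variable fewer with the same `η`; this is why the induction runs over `H*`-valued operators. The
condition `(j : ℕ) = 0` for the norm is a form that passes to `castSucc` unchanged. -/
theorem tendsto_arensFunctional_comp {Ω : Type w} [Preorder Ω] [IsDirectedOrder Ω] [Nonempty Ω]
    {H : Type v} [NormedAddCommGroup H] [NormedSpace ℝ H] [Lattice H] [IsOrderedAddMonoid H]
    [HasSolidNorm H] {η : Ω → Bidual H} (hη : DecreasesToZero η) :
    ∀ {n : ℕ} {E : Fin (n + 1) → Type u} [∀ j, NormedAddCommGroup (E j)]
    [∀ j, NormedSpace ℝ (E j)] [∀ j, Lattice (E j)] [∀ j, IsOrderedAddMonoid (E j)]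
    [∀ j, HasSolidNorm (E j)]
    (_ : ∀ j : Fin (n + 1), 1 ≤ (j : ℕ) → ∀ T : E j →ₗ[ℝ] StrongDual ℝ H,
      IsRegularLinear T → IsWeaklyCompactOperator T)
    (_ : ∀ j : Fin (n + 1), (j : ℕ) = 0 → HasOrderContinuousNorm (StrongDual ℝ (E j)))
    {ξ : ∀ j, Bidual (E j)} (_ : ∀ j, 0 ≤ ξ j)
    {D : ContinuousMultilinearMap ℝ E (StrongDual ℝ H)}
    (_ : IsPositiveMultilinear D.toMultilinearMap),
    Tendsto (fun α => arensFunctional ξ ((η α).compContinuousMultilinearMap D)) atTop (𝓝 0)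
  | 0, E, _, _, _, _, _, _, hnorm, ξ, hξ, D, hD => by
    let T : E (Fin.last 0) →L[ℝ] StrongDual ℝ H := D.curryRight fun j => j.elim0
    have hT : ∀ x, 0 ≤ x → 0 ≤ T x := fun x hx => curryRight_apply_nonneg hD (fun j => j.elim0) hx
    -- Only the first variable is left: positivity of `T` carries `η ↓ 0` over to `E_1*`, where
    -- order continuity of the norm applies.
    have hdec : DecreasesToZero fun α => (η α) ∘L T :=
      decreasesToZero_of_tendsto_apply (fun α β h x hx => hη.1 h (T x) (hT x hx))
        (fun α x hx => hη.2.1 ⟨α, rfl⟩ (T x) (hT x hx)) fun x _ => hη.tendsto_apply (T x)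
    have h := (hnorm (Fin.last 0) rfl).tendsto_norm hdec
    exact squeeze_zero_norm (fun α => (ξ (Fin.last 0)).le_opNorm ((η α) ∘L T))
      (by simpa using h.const_mul ‖ξ (Fin.last 0)‖)
  | n + 1, E, _, _, _, _, _, hweak, hnorm, ξ, hξ, D, hD => by
    have h := tendsto_arensFunctional_comp hη (E := fun j : Fin (n + 1) => E j.castSucc)
      (fun j hj => hweak j.castSucc hj) (fun j hj => hnorm j.castSucc hj)
      (fun j => hξ j.castSucc) (isPositiveMultilinear_applyLastDual (hξ (Fin.last _)) hD)
    refine h.congr fun α => ?_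
    rw [arensFunctional_succ ξ, ContinuousLinearMap.comp_apply,
      applyLast_comp_eq (hweak (Fin.last _) (by simp)) _ hD]

theorem tendsto_arensFunctional_update {Ω : Type w} [Preorder Ω] [IsDirectedOrder Ω]
    [Nonempty Ω] : ∀ {m : ℕ} {E : Fin m → Type u} [∀ j, NormedAddCommGroup (E j)]
    [∀ j, NormedSpace ℝ (E j)] [∀ j, Lattice (E j)] [∀ j, IsOrderedAddMonoid (E j)]
    [∀ j, HasSolidNorm (E j)]
    (_ : ∀ j k : Fin m, 1 ≤ (j : ℕ) → j < k → ∀ T : E j →ₗ[ℝ] StrongDual ℝ (E k),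
      IsRegularLinear T → IsWeaklyCompactOperator T)
    (_ : ∀ j : Fin m, (j : ℕ) = 0 → HasOrderContinuousNorm (StrongDual ℝ (E j)))
    {ξ : ∀ j, Bidual (E j)} (_ : ∀ j, 0 ≤ ξ j) {B : ContinuousMultilinearMap ℝ E ℝ}
    (_ : IsPositiveMultilinear B.toMultilinearMap) (i : Fin m) {η : Ω → Bidual (E i)}
    (_ : DecreasesToZero η),
    Tendsto (fun α => arensFunctional (Function.update ξ i (η α)) B) atTop (𝓝 0)
  | 0, _, _, _, _, _, _, _, _, _, _, _, _, i, _, _ => i.elim0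
  | n + 1, E, _, _, _, _, _, hweak, hnorm, ξ, hξ, B, hB, i, η, hη => by
    induction i using Fin.lastCases with
    | last =>
      simp only [arensFunctional_update_last]
      cases n with
      -- The moving slot is the only one left, so the net is evaluated at one fixed functional and
      -- neither hypothesis on the spaces enters.
      | zero => exact hη.tendsto_apply (B.curryRight fun j => j.elim0)
      | succ n =>
        exact tendsto_arensFunctional_comp hη
          (fun j hj => hweak j.castSucc (Fin.last _) hj (Fin.castSucc_lt_last j))
          (fun j hj => hnorm j.castSucc hj) (fun j => hξ j.castSucc)
          (D := B.curryRight) fun x hx y hy => curryRight_apply_nonneg hB hx hy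
    | cast i =>
      simp only [arensFunctional_update_castSucc]
      exact tendsto_arensFunctional_update (E := fun j : Fin n => E j.castSucc)
        (fun j k hj hjk => hweak j.castSucc k.castSucc hj (Fin.castSucc_lt_castSucc_iff.2 hjk))
        (fun j hj => hnorm j.castSucc hj) (fun j => hξ j.castSucc)
        (isPositiveMultilinear_applyLast (hξ _) hB) i hη

/-! ### From scalar forms to the Arens extension -/

section ArensExtension

variable {m : ℕ} {E : Fin m → Type u} {F : Type v}
  [∀ j, NormedAddCommGroup (E j)] [∀ j, NormedSpace ℝ (E j)] [∀ j, Lattice (E j)]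
  [∀ j, IsOrderedAddMonoid (E j)] [∀ j, HasSolidNorm (E j)]
  [NormedAddCommGroup F] [NormedSpace ℝ F] [Lattice F] [IsOrderedAddMonoid F] [HasSolidNorm F]

theorem isPositiveMultilinear_comp {A : ContinuousMultilinearMap ℝ E F}
    (hA : IsPositiveMultilinear A.toMultilinearMap) {φ : StrongDual ℝ F} (hφ : 0 ≤ φ) :
    IsPositiveMultilinear (φ.compContinuousMultilinearMap A).toMultilinearMap :=
  fun x hx => hφ (A x) (hA x hx)

theorem isPositiveMultilinear_arensExtension {A : ContinuousMultilinearMap ℝ E F}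
    (hA : IsPositiveMultilinear A.toMultilinearMap) :
    IsPositiveMultilinear (G := fun j => Bidual (E j)) (H := Bidual F) (arensExtension A) :=
  fun _ hξ _ hφ => arensFunctional_nonneg hξ (isPositiveMultilinear_comp hA hφ)

theorem arensExtension_sub (A B : ContinuousMultilinearMap ℝ E F) (ξ : ∀ j, Bidual (E j)) :
    arensExtension (A - B) ξ = arensExtension A ξ - arensExtension B ξ := by
  change arensFunctional ξ ∘L _ = arensFunctional ξ ∘L _ - arensFunctional ξ ∘L _
  rw [map_sub, ContinuousLinearMap.comp_sub]

theorem decreasesToZero_arensExtension_update {Ω : Type w} [Preorder Ω] [IsDirectedOrder Ω]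
    [Nonempty Ω]
    (hweak : ∀ j k : Fin m, 1 ≤ (j : ℕ) → j < k → ∀ T : E j →ₗ[ℝ] StrongDual ℝ (E k),
      IsRegularLinear T → IsWeaklyCompactOperator T)
    (hnorm : ∀ j : Fin m, (j : ℕ) = 0 → HasOrderContinuousNorm (StrongDual ℝ (E j)))
    {A : ContinuousMultilinearMap ℝ E F} (hA : IsPositiveMultilinear A.toMultilinearMap)
    {ξ : ∀ j, Bidual (E j)} (hξ : ∀ j, 0 ≤ ξ j) (i : Fin m) {η : Ω → Bidual (E i)}
    (hη : DecreasesToZero η) :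
    DecreasesToZero fun α => arensExtension A (Function.update ξ i (η α)) := by
  have hpos : ∀ α j, 0 ≤ Function.update ξ i (η α) j := fun α j => by
    rcases eq_or_ne j i with rfl | h
    · simpa using hη.2.1 ⟨α, rfl⟩
    · simpa [h] using hξ j
  refine decreasesToZero_of_tendsto_apply (fun α β h => ?_)
    (fun α => isPositiveMultilinear_arensExtension hA _ (hpos α)) fun φ hφ =>
      tendsto_arensFunctional_update hweak hnorm hξ (isPositiveMultilinear_comp hA hφ) i hη
  refine IsPositiveMultilinear.mono (E := fun j => Bidual (E j)) (F := Bidual F)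
    (isPositiveMultilinear_arensExtension hA) (hpos β) fun j => ?_
  rcases eq_or_ne j i with rfl | hj
  · simpa using hη.1 h
  · simp [hj]

/-- The Arens extension of a difference of positive operators is separately order continuous. -/
theorem isSeparatelyOrderContinuous_arensExtension_sub
    (hweak : ∀ j k : Fin m, 1 ≤ (j : ℕ) → j < k → ∀ T : E j →ₗ[ℝ] StrongDual ℝ (E k),
      IsRegularLinear T → IsWeaklyCompactOperator T)
    (hnorm : ∀ j : Fin m, (j : ℕ) = 0 → HasOrderContinuousNorm (StrongDual ℝ (E j)))
    {A B : ContinuousMultilinearMap ℝ E F} (hA : IsPositiveMultilinear A.toMultilinearMap)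
    (hB : IsPositiveMultilinear B.toMultilinearMap) :
    IsSeparatelyOrderContinuous.{w} (G := fun j => Bidual (E j)) (H := Bidual F)
      (arensExtension (A - B)) := by
  intro i ξ Ω _ _ _ x ⟨y, hy, hxy⟩
  have hA' := isPositiveMultilinear_arensExtension hA
  have hB' := isPositiveMultilinear_arensExtension hB
  have hzA := decreasesToZero_arensExtension_update hweak hnorm hA (fun j => abs_nonneg (ξ j)) i hy
  have hzB := decreasesToZero_arensExtension_update hweak hnorm hB (fun j => abs_nonneg (ξ j)) i hy
  -- Replacing the fixed arguments by their moduli and `x α` by its dominating `y α` gives a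
  -- majorant that decreases to `0`.
  have hbound : ∀ {C : ContinuousMultilinearMap ℝ E F},
      IsPositiveMultilinear (G := fun j => Bidual (E j)) (H := Bidual F) (arensExtension C) →
      ∀ α, |arensExtension C (Function.update ξ i (x α))| ≤
        arensExtension C (Function.update (fun j => |ξ j|) i (y α)) := fun hC α => by
    refine (hC.abs_apply_le _).trans (IsPositiveMultilinear.mono
      (E := fun j => Bidual (E j)) (F := Bidual F) hC (fun j => abs_nonneg _) fun j => ?_)
    rcases eq_or_ne j i with rfl | hj
    · simpa using hxy α
    · simp [hj]
  refine ⟨fun α => arensExtension A (Function.update (fun j => |ξ j|) i (y α)) +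
    arensExtension B (Function.update (fun j => |ξ j|) i (y α)),
    decreasesToZero_of_tendsto_apply (hzA.1.add hzB.1)
      (fun α => add_nonneg (hzA.2.1 ⟨α, rfl⟩) (hzB.2.1 ⟨α, rfl⟩))
      (fun φ _ => by simpa using (hzA.tendsto_apply φ).add (hzB.tendsto_apply φ)), fun α => ?_⟩
  rw [sub_zero]
  change |arensExtension (A - B) (Function.update ξ i (x α))| ≤ _
  rw [arensExtension_sub]
  exact abs_sub_le_add (hbound hA' α) (hbound hB' α)

end ArensExtension

end BanachLattice

theorem mainTheorem10 {m : ℕ} (hm : 2 ≤ m) {E : Fin m → Type u} {F : Type v}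
    [∀ j, NormedAddCommGroup (E j)] [∀ j, NormedSpace ℝ (E j)] [∀ j, CompleteSpace (E j)]
    [∀ j, Lattice (E j)] [∀ j, IsOrderedAddMonoid (E j)] [∀ j, IsOrderedModule ℝ (E j)]
    [∀ j, HasSolidNorm (E j)]
    [NormedAddCommGroup F] [NormedSpace ℝ F] [CompleteSpace F] [Lattice F]
    [IsOrderedAddMonoid F] [IsOrderedModule ℝ F] [HasSolidNorm F]
    (hweak : ∀ j k : Fin m, 1 ≤ (j : ℕ) → j < k → ∀ T : E j →ₗ[ℝ] StrongDual ℝ (E k),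
      BanachLattice.IsRegularLinear T → BanachLattice.IsWeaklyCompactOperator T)
    (hnorm : BanachLattice.HasOrderContinuousNorm (StrongDual ℝ (E ⟨0, Nat.zero_lt_two.trans_le hm⟩)))
    (A : MultilinearMap ℝ E F) (hA : BanachLattice.IsRegularMultilinear A) :
    BanachLattice.IsSeparatelyOrderContinuous.{w}
      (G := fun j => BanachLattice.Bidual (E j)) (H := BanachLattice.Bidual F)
      (BanachLattice.arensExtension hA.toContinuous) := by
  obtain ⟨A₁, A₂, h₁, h₂, rfl⟩ := hA
  have hreg : ∀ {A : MultilinearMap ℝ E F}, BanachLattice.IsPositiveMultilinear A →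
      BanachLattice.IsRegularMultilinear A := fun {A} h =>
    ⟨A, 0, h, fun _ _ => le_rfl, (sub_zero A).symm⟩
  -- Each positive part is itself regular, hence continuous, and the continuous version of `A₁ - A₂`
  -- is definitionally the difference of the continuous versions.
  exact BanachLattice.isSeparatelyOrderContinuous_arensExtension_sub hweak
    (fun j hj => by
      obtain rfl : j = ⟨0, Nat.zero_lt_two.trans_le hm⟩ := Fin.ext hj
      exact hnorm)
    (A := (hreg h₁).toContinuous) (B := (hreg h₂).toContinuous) h₁ h₂
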